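/- Let $X$ be a finite linearly ordered set. Order the nonassociative words in $X$ by length, words of equal length $>1$ being compared lexicographically by their two factors and letters as in $X$. The set $S(X)^*$ of irreducible words is defined inductively: every letter is irreducible, and $wv$ is irreducible precisely if $w$ and $v$ are irreducible, $v<w$, and $v$ is not one of the two immediate factors $w_1,w_2$ of $w$ in case $w=w_1w_2$. The free Steiner loop on $X$ is $S(X)=S(X)^*\cup\{\emptyset\}$ with identity $\emptyset$ and the commutative multiplication given on irreducible words by $v\cdot v=\emptyset$; $w\cdot v=v\cdot w=u$ if $w$ is the word $uv$ or $vu$; and $w\cdot v=v\cdot w=wv$ if $wv$ is irreducible. For $v\in S(X)$ let $R_v:x\mapsto x\cdot v$. Let $G$ be the multiplication group of $S(X)$, i.e. the permutation group generated by all left and right translations of $S(X)$, and let $\mathrm{Stab}_G(\emptyset)$ be the inner mapping group, i.e. the stabilizer of $\emptyset$ in $G$. Then: 1. If $|X|\neq 2$, then for each $v\in S(X)^*$ the subgroup $C_v=\langle R_v\rangle$ of $G$ has order $2$, and $G$ is the (internal) free product of these subgroups: the canonical homomorphism $\ast_{v\in S(X)^*}C_v\to G$ is an isomorphism. 2. $G=\{R_v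 : v\in S(X)\}\cdot\mathrm{Stab}_G(\emptyset)$. Moreover, $\mathrm{Stab}_G(\emptyset)$ is a free group, and it is the subgroup of $G$ generated by the elements $R_vR_wR_{v\cdot w}$, $v,w\in S(X)$. -/

import Mathlib

universe u

/-- A loop: a set with a binary operation `*` and a two-sided identity `1` such that the equations
`a * y = b` and `x * a = b` are uniquely solvable. -/
class AlgLoop (L : Type u) extends Mul L, One L where
  one_mul' : ∀ x : L, 1 * x = x
  mul_one' : ∀ x : L, x * 1 = x
  left_solvable : ∀ a b : L, ∃! y : L, a * y = b
  right_solvable : ∀ a b : L, ∃! x : L, x * a = b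

namespace AlgLoop

variable {L : Type u} [AlgLoop L]

/-- The left translation `y ↦ x * y`. -/
noncomputable def leftTranslation (x : L) : Equiv.Perm L :=
  Equiv.ofBijective (fun y => x * y)
    (Function.bijective_iff_existsUnique _ |>.2 (left_solvable x))

/-- The right translation `y ↦ y * x`. -/
noncomputable def rightTranslation (x : L) : Equiv.Perm L :=
  Equiv.ofBijective (fun y => y * x)
    (Function.bijective_iff_existsUnique _ |>.2 (right_solvable x))

variable (L) in
/-- The multiplication group of `L`: the permutation group generated by all left and right
translations. -/
def multGroup : Subgroup (Equiv.Perm L) :=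
  Subgroup.closure (Set.range leftTranslation ∪ Set.range rightTranslation)

variable (L) in
/-- The inner mapping group of `L`: the stabilizer of the identity in the multiplication group. -/
def innerMappingGroup : Subgroup (multGroup L) :=
  MulAction.stabilizer (multGroup L) (1 : L)

/-- The right translation `R_x`, as an element of the multiplication group. -/
noncomputable def R (x : L) : multGroup L :=
  ⟨rightTranslation x, Subgroup.subset_closure (Or.inr ⟨x, rfl⟩)⟩

end AlgLoop

/-- A Steiner loop: a commutative loop with `x * (x * y) = y` and `x * x = 1`. -/
class SteinerLoop (L : Type u) extends AlgLoop L where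
  mul_comm' : ∀ x y : L, x * y = y * x
  mul_mul_cancel : ∀ x y : L, x * (x * y) = y
  mul_self : ∀ x : L, x * x = 1

namespace FreeSteiner

variable {X : Type u} [LinearOrder X]

/-- The order on nonassociative words: letters are compared as in `X`, shorter words are smaller,
and words of equal length greater than `1` are compared lexicographically by their two factors. -/
def WordLT : FreeMagma X → FreeMagma X → Prop
  | .of x, .of y => x < y
  | .of _, .mul _ _ => True
  | .mul _ _, .of _ => False
  | .mul v₁ v₂, .mul w₁ w₂ =>
      (FreeMagma.mul v₁ v₂).length < (FreeMagma.mul w₁ w₂).length ∨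
        ((FreeMagma.mul v₁ v₂).length = (FreeMagma.mul w₁ w₂).length ∧
          (WordLT v₁ w₁ ∨ (v₁ = w₁ ∧ WordLT v₂ w₂)))

/-- `v` is one of the two immediate factors of the word `w`. -/
def IsFactor (v : FreeMagma X) : FreeMagma X → Prop
  | .of _ => False
  | .mul w₁ w₂ => v = w₁ ∨ v = w₂

/-- The irreducible words (S-words): letters, and words `w v` with `w`, `v` irreducible, `v < w`,
and `v` not an immediate factor of `w`. -/
def IsSWord : FreeMagma X → Prop
  | .of _ => True
  | .mul w v => IsSWord w ∧ IsSWord v ∧ WordLT v w ∧ ¬ IsFactor v w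

end FreeSteiner

open FreeSteiner in
/-- The set `S(X)*` of irreducible words. -/
def SWord (X : Type u) [LinearOrder X] : Type u := {w : FreeMagma X // IsSWord w}

/-- The set `S(X) = S(X)* ∪ {∅}`. -/
inductive FreeSteinerLoop (X : Type u) [LinearOrder X] : Type u
  | empty : FreeSteinerLoop X
  | word (w : SWord X) : FreeSteinerLoop X

namespace FreeSteiner

variable {X : Type u} [LinearOrder X]

theorem WordLT.trichotomy : ∀ v w : FreeMagma X, WordLT v w ∨ v = w ∨ WordLT w v
  | .of x, .of y => by
      rcases lt_trichotomy x y with h | h | h <;> simp [WordLT, h]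
  | .of _, .mul _ _ => by simp [WordLT]
  | .mul _ _, .of _ => by simp [WordLT]
  | .mul v₁ v₂, .mul w₁ w₂ => by
      have h1 := WordLT.trichotomy v₁ w₁
      have h2 := WordLT.trichotomy v₂ w₂
      have h3 : v₁ = w₁ → v₂ = w₂ → FreeMagma.mul v₁ v₂ = FreeMagma.mul w₁ w₂ := by
        rintro rfl rfl; rfl
      simp only [WordLT]
      grind

theorem WordLT.asymm : ∀ v w : FreeMagma X, WordLT v w → ¬ WordLT w v
  | .of x, .of y => by simpa [WordLT] using le_of_lt
  | .of _, .mul _ _ => by simp [WordLT]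
  | .mul _ _, .of _ => by simp [WordLT]
  | .mul v₁ v₂, .mul w₁ w₂ => by
      have h1 := WordLT.asymm v₁ w₁
      have h2 := WordLT.asymm v₂ w₂
      have h3 := WordLT.asymm v₁ v₁
      simp only [WordLT]
      grind

theorem WordLT.length_le {v w : FreeMagma X} (h : WordLT v w) : v.length ≤ w.length := by
  match v, w, h with
  | .of _, .of _, _ => exact le_rfl
  | .of _, .mul a b, _ => exact (FreeMagma.mul a b).length_pos
  | .mul _ _, .mul _ _, h => exact h.elim le_of_lt fun h => h.1.le

open Classical in
/-- If `v` is the word `w u` or `u w`, this is `u`; otherwise it is undefined. -/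
noncomputable def cofactor : SWord X → SWord X → Option (SWord X)
  | ⟨.of _, _⟩, _ => none
  | ⟨.mul a b, h⟩, w =>
      if w.1 = a then some ⟨b, h.2.1⟩ else if w.1 = b then some ⟨a, h.1⟩ else none

theorem cofactor_eq_none {v w : SWord X} : cofactor v w = none ↔ ¬ IsFactor w.1 v.1 := by
  obtain ⟨_ | ⟨a, b⟩, h⟩ := v
  · simp [cofactor, IsFactor]
  · simp only [cofactor, IsFactor]; split_ifs <;> simp_all

open Classical in
/-- The product of two irreducible words: `∅` if they are equal; the other factor if one of them is
a factor of the other; otherwise the word formed with the larger one first. -/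
noncomputable def mulWord (v w : SWord X) : FreeSteinerLoop X :=
  if hne : v = w then .empty
  else if hv : IsFactor w.1 v.1 then .word ((cofactor v w).get (by
    rw [Option.isSome_iff_ne_none, ne_eq, cofactor_eq_none]; exact not_not.2 hv))
  else if hw : IsFactor v.1 w.1 then .word ((cofactor w v).get (by
    rw [Option.isSome_iff_ne_none, ne_eq, cofactor_eq_none]; exact not_not.2 hw))
  else if h : WordLT w.1 v.1 then .word ⟨.mul v.1 w.1, v.2, w.2, h, hv⟩
  else .word ⟨.mul w.1 v.1, w.2, v.2, by
    rcases WordLT.trichotomy v.1 w.1 with h' | h' | h'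
    · exact h'
    · exact absurd (Subtype.ext h') hne
    · exact absurd h' h, hw⟩

/-- The multiplication of `S(X)`, with `∅` as identity. -/
noncomputable def mul : FreeSteinerLoop X → FreeSteinerLoop X → FreeSteinerLoop X
  | .empty, b => b
  | a, .empty => a
  | .word v, .word w => mulWord v w

theorem IsFactor.length_lt {X : Type u} {v w : FreeMagma X} (h : IsFactor v w) : v.length < w.length := by
  cases w with
  | of => exact h.elim
  | mul a b =>
    have := a.length_pos
    have := b.length_pos
    simp only [IsFactor, FreeMagma.length] at *
    rcases h with rfl | rfl <;> omega

theorem IsFactor.exists_eq {X : Type u} {v w : FreeMagma X} (h : IsFactor v w) :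
    ∃ u, w = .mul v u ∨ w = .mul u v := by
  cases w with
  | of => exact h.elim
  | mul a b =>
    rcases h with rfl | rfl
    · exact ⟨b, Or.inl rfl⟩
    · exact ⟨a, Or.inr rfl⟩

/-- The word `v` is the irreducible product of `a` and `b`, in one of the two orders. -/
def IsProd (v a b : SWord X) : Prop := v.1 = .mul a.1 b.1 ∨ v.1 = .mul b.1 a.1

theorem IsProd.facts {v a b : SWord X} (h : IsProd v a b) :
    IsFactor a.1 v.1 ∧ IsFactor b.1 v.1 ∧ a ≠ b ∧ ¬ IsFactor a.1 b.1 ∧ ¬ IsFactor b.1 a.1 := by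
  have irr : ∀ w : FreeMagma X, ¬ WordLT w w := fun w h => WordLT.asymm w w h h
  obtain ⟨v, hv⟩ := v
  have key : ∀ a b : FreeMagma X, WordLT b a → ¬ IsFactor b a → a ≠ b ∧ ¬ IsFactor a b ∧
      ¬ IsFactor b a := fun a b h1 h2 =>
    ⟨fun h => irr a (by rw [← h] at h1; exact h1),
      fun h => by have := h.length_lt; have := h1.length_le; omega, h2⟩
  rcases h with h | h <;> (dsimp only at h; subst h)
  · obtain ⟨h1, h2, h3⟩ := key _ _ hv.2.2.1 hv.2.2.2
    exact ⟨Or.inl rfl, Or.inr rfl, fun h => h1 (congrArg Subtype.val h), h2, h3⟩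
  · obtain ⟨h1, h2, h3⟩ := key _ _ hv.2.2.1 hv.2.2.2
    exact ⟨Or.inr rfl, Or.inl rfl, fun h => h1 (congrArg Subtype.val h).symm, h3, h2⟩

theorem IsProd.symm {v a b : SWord X} (h : IsProd v a b) : IsProd v b a := Or.symm h

theorem IsProd.cofactor {v a b : SWord X} (h : IsProd v a b) : cofactor v a = some b := by
  have hf := h.facts
  obtain ⟨v, hv⟩ := v
  rcases h with h | h <;> (dsimp only at h; subst h)
  · simp [FreeSteiner.cofactor]; rfl
  · have : a.1 ≠ b.1 := fun h => hf.2.2.1 (Subtype.ext h)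
    simp [FreeSteiner.cofactor, this]; rfl

theorem IsProd.unique {v w a b : SWord X} (h : IsProd v a b) (h' : IsProd w a b) : v = w := by
  obtain ⟨v, hv⟩ := v
  obtain ⟨w, hw⟩ := w
  apply Subtype.ext
  rcases h with h | h <;> rcases h' with h' | h' <;> dsimp only at h h' ⊢ <;> subst h <;> subst h'
  · rfl
  · exact absurd hw.2.2.1 (WordLT.asymm _ _ hv.2.2.1)
  · exact absurd hw.2.2.1 (WordLT.asymm _ _ hv.2.2.1)
  · rfl

theorem IsFactor.exists_isProd {v w : SWord X} (h : IsFactor w.1 v.1) : ∃ u, IsProd v w u := by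
  obtain ⟨v, hv⟩ := v
  obtain ⟨u, rfl | rfl⟩ := h.exists_eq
  · exact ⟨⟨u, hv.2.1⟩, Or.inl rfl⟩
  · exact ⟨⟨u, hv.1⟩, Or.inr rfl⟩

theorem mulWord_self (v : SWord X) : mulWord v v = .empty := by simp [mulWord]

theorem mulWord_left {v a b : SWord X} (h : IsProd v a b) : mulWord v a = .word b := by
  have hf := h.facts
  have hne : v ≠ a := fun e => by have := hf.1.length_lt; rw [e] at this; omega
  simp [mulWord, hne, hf.1, h.cofactor]

theorem mulWord_right {v a b : SWord X} (h : IsProd v a b) : mulWord a v = .word b := by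
  have hf := h.facts
  have hlt := hf.1.length_lt
  have hne : a ≠ v := fun e => by rw [e] at hlt; omega
  have hn : ¬ IsFactor v.1 a.1 := fun e => by have := e.length_lt; omega
  simp [mulWord, hne, hf.1, hn, h.cofactor]

theorem exists_mulWord {a b : SWord X} (hne : a ≠ b) (h1 : ¬ IsFactor a.1 b.1)
    (h2 : ¬ IsFactor b.1 a.1) : ∃ v, IsProd v a b ∧ mulWord a b = .word v := by
  by_cases h : WordLT b.1 a.1
  · exact ⟨⟨.mul a.1 b.1, a.2, b.2, h, h2⟩, Or.inl rfl, by simp [mulWord, *]⟩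
  · refine ⟨⟨.mul b.1 a.1, b.2, a.2, ?_, h1⟩, Or.inr rfl, by simp [mulWord, *]⟩
    rcases WordLT.trichotomy a.1 b.1 with h' | h' | h'
    · exact h'
    · exact absurd (Subtype.ext h') hne
    · exact absurd h' h

theorem mulWord_of_isProd {v a b : SWord X} (h : IsProd v a b) : mulWord a b = .word v := by
  have hf := h.facts
  obtain ⟨w, hw, e⟩ := exists_mulWord hf.2.2.1 hf.2.2.2.1 hf.2.2.2.2
  rw [e, h.unique hw]

/-- Two irreducible words are equal, or form, together with a third word, a triple in which one of
the three is the irreducible product of the other two. -/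
theorem word_cases (v w : SWord X) : v = w ∨ (∃ u, IsProd v w u) ∨ (∃ u, IsProd w v u) ∨
    ∃ u, IsProd u v w := by
  by_cases hne : v = w
  · exact Or.inl hne
  by_cases h1 : IsFactor w.1 v.1
  · exact Or.inr (Or.inl h1.exists_isProd)
  by_cases h2 : IsFactor v.1 w.1
  · exact Or.inr (Or.inr (Or.inl h2.exists_isProd))
  obtain ⟨u, hu, -⟩ := exists_mulWord hne h2 h1
  exact Or.inr (Or.inr (Or.inr ⟨u, hu⟩))

theorem mul_comm' (a b : FreeSteinerLoop X) : mul a b = mul b a := by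
  rcases a with _ | v <;> rcases b with _ | w <;> try rfl
  change mulWord v w = mulWord w v
  rcases word_cases v w with rfl | ⟨u, h⟩ | ⟨u, h⟩ | ⟨u, h⟩
  · rfl
  · rw [mulWord_left h, mulWord_right h]
  · rw [mulWord_left h, mulWord_right h]
  · rw [mulWord_of_isProd h, mulWord_of_isProd h.symm]

theorem mul_self' (a : FreeSteinerLoop X) : mul a a = .empty := by
  rcases a with _ | v
  · rfl
  · exact mulWord_self v

theorem mul_empty' (a : FreeSteinerLoop X) : mul a .empty = a := by
  cases a <;> rfl

theorem mul_mul_cancel' (a b : FreeSteinerLoop X) : mul a (mul a b) = b := by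
  rcases a with _ | v
  · rfl
  rcases b with _ | w
  · exact mulWord_self v
  change mul (.word v) (mulWord v w) = _
  rcases word_cases v w with rfl | ⟨u, h⟩ | ⟨u, h⟩ | ⟨u, h⟩
  · rw [mulWord_self]; rfl
  · rw [mulWord_left h]; exact mulWord_left h.symm
  · rw [mulWord_right h]; exact mulWord_of_isProd h
  · rw [mulWord_of_isProd h]; exact mulWord_right h

/-- The free Steiner loop `S(X)`. -/
noncomputable instance instSteinerLoop : SteinerLoop (FreeSteinerLoop X) where
  mul := mul
  one := .empty
  one_mul' _ := rfl
  mul_one' := mul_empty'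
  left_solvable a b := ⟨mul a b, mul_mul_cancel' a b, fun y (hy : mul a y = b) => by
    rw [← hy, mul_mul_cancel']⟩
  right_solvable a b := ⟨mul a b, by
    change mul (mul a b) a = b
    rw [mul_comm', mul_mul_cancel'], fun y (hy : mul y a = b) => by
    rw [← hy, mul_comm' y a, mul_mul_cancel']⟩
  mul_comm' := mul_comm'
  mul_mul_cancel := mul_mul_cancel'
  mul_self := mul_self'

end FreeSteiner

/-! In a Steiner loop left and right translations coincide and each `R v` is an involution, so these
generate `G`. Since `R v` sends `1` to `v`, they form a transversal of the stabilizer of `1`, and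
Schreier rewriting shows that the elements `innerGen v x` generate it.

Free product: apply successively different translations to a word longer than all of them. Each step
creates a longer word, whose only short factor is the one just multiplied in, so nothing cancels and
the product is not the identity (`exists_isProd_prod_smul`, `prod_R_ne_one`). This uses arbitrarily
long words, hence three letters; with at most one letter there is at most one irreducible word.

Freeness: up to inversion and trivial cases, the Schreier generators form a basis. Given their
images in a group `H`, the translations are lifted to involutions of `L × H` twisted by a cocycle;
as `G` has no further relations it acts there, and the `H`-coordinate over `1` is the required
homomorphism. With two letters the loop is a group and the stabilizer is trivial. -/

namespace SteinerLoop

open AlgLoop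

/-! ### Generators of the multiplication group and of the inner mapping group. -/

section Generation

variable {L : Type u} [SteinerLoop L]

theorem mul_mul_cancel_right (x v : L) : x * v * v = x := by
  rw [mul_comm' (x * v), mul_comm' x, mul_mul_cancel]

theorem R_smul (v x : L) : R v • x = x * v := rfl

theorem multGroup_ext {g h : multGroup L} (e : ∀ x : L, g • x = h • x) : g = h :=
  Subtype.ext (Equiv.ext e)

theorem R_mul_self (v : L) : R v * R v = 1 :=
  multGroup_ext fun x => by
    rw [mul_smul, R_smul, R_smul, mul_mul_cancel_right, one_smul]

theorem R_inv (v : L) : (R v)⁻¹ = R v := inv_eq_of_mul_eq_one_left (R_mul_self v)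

theorem R_one : R (1 : L) = 1 :=
  multGroup_ext fun x => by rw [R_smul, one_smul, AlgLoop.mul_one']

theorem R_ne_one {v : L} (hv : v ≠ 1) : R v ≠ 1 := fun h => hv <| by
  rw [← AlgLoop.one_mul' v, ← R_smul, h, one_smul]

/-- Every element of the multiplication group of a Steiner loop is a product of right
translations. -/
theorem multGroup_induction {p : multGroup L → Prop} (one : p 1)
    (mul : ∀ v g, p g → p (R v * g)) (g : multGroup L) : p g := by
  have key : ∀ σ ∈ Set.range (leftTranslation (L := L)) ∪ Set.range rightTranslation,
      ∃ v : L, σ = (R v : Equiv.Perm L) := by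
    rintro σ (⟨v, rfl⟩ | ⟨v, rfl⟩)
    · exact ⟨v, Equiv.ext fun x => mul_comm' v x⟩
    · exact ⟨v, rfl⟩
  obtain ⟨σ, hσ⟩ := g
  refine Subgroup.closure_induction_left (p := fun σ hσ => p ⟨σ, hσ⟩) one ?_ ?_ hσ
  · intro σ hσ τ hτ h
    obtain ⟨v, rfl⟩ := key σ hσ
    exact mul v _ h
  · intro σ hσ τ hτ h
    obtain ⟨v, rfl⟩ := key σ hσ
    have := mul v _ h
    rwa [← R_inv] at this

theorem exists_eq_R_mul (g : multGroup L) :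
    ∃ v : L, ∃ h ∈ innerMappingGroup L, g = R v * h := by
  refine ⟨g • (1 : L), (R (g • (1 : L)))⁻¹ * g, ?_, by group⟩
  rw [innerMappingGroup, MulAction.mem_stabilizer_iff, R_inv, mul_smul, R_smul, mul_self]

/-- The inner mapping `R_{xv} R_v R_x`. -/
noncomputable def innerGen (v x : L) : innerMappingGroup L :=
  ⟨R (x * v) * R v * R x, by
    rw [innerMappingGroup, MulAction.mem_stabilizer_iff, mul_smul, mul_smul, R_smul, R_smul,
      R_smul, AlgLoop.one_mul', mul_self]⟩

theorem coe_innerGen (v x : L) : (innerGen v x : multGroup L) = R (x * v) * R v * R x := rfl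

/-- The points `x` and `x * v` give the same generator up to inversion, so a free basis may keep
only one of them. -/
theorem innerGen_mul_left_inv (v x : L) : innerGen v (x * v) = (innerGen v x)⁻¹ :=
  Subtype.ext <| by
    rw [Subgroup.coe_inv, coe_innerGen, coe_innerGen, mul_mul_cancel_right, mul_inv_rev,
      mul_inv_rev, R_inv, R_inv, R_inv, mul_assoc]

theorem innerGen_one_left (x : L) : innerGen 1 x = 1 :=
  Subtype.ext <| by
    rw [coe_innerGen, AlgLoop.mul_one', R_one, mul_one, R_mul_self, Subgroup.coe_one]

theorem innerGen_one_right (v : L) : innerGen v 1 = 1 :=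
  Subtype.ext <| by
    rw [coe_innerGen, AlgLoop.one_mul', R_one, mul_one, R_mul_self, Subgroup.coe_one]

theorem innerGen_self (v : L) : innerGen v v = 1 :=
  Subtype.ext <| by
    rw [coe_innerGen, mul_self, R_one, one_mul, R_mul_self, Subgroup.coe_one]

theorem exists_eq_R_mul_closure (g : multGroup L) : ∃ v : L,
    ∃ h ∈ Subgroup.closure (Set.range fun p : L × L => innerGen p.1 p.2),
      g = R v * (h : multGroup L) := by
  induction g using multGroup_induction with
  | one => exact ⟨1, 1, one_mem _, by rw [R_one, Subgroup.coe_one, one_mul]⟩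
  | mul w g ih =>
    obtain ⟨v, h, hh, rfl⟩ := ih
    -- Schreier rewriting: `R w * R v = R (v * w) * innerGen w v`, because `R (v * w)` is an
    -- involution.
    refine ⟨v * w, innerGen w v * h, mul_mem (Subgroup.subset_closure ⟨(w, v), rfl⟩) hh, ?_⟩
    rw [Subgroup.coe_mul, coe_innerGen]
    simp only [← mul_assoc, R_mul_self, one_mul]

theorem closure_innerGen :
    Subgroup.closure (Set.range fun p : L × L => innerGen p.1 p.2) = ⊤ := by
  refine eq_top_iff.2 fun g _ => ?_
  obtain ⟨v, h, hh, e⟩ := exists_eq_R_mul_closure (g : multGroup L)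
  have hv : v = 1 := by
    have h1 : (g : multGroup L) • (1 : L) = 1 := g.2
    have h2 : (h : multGroup L) • (1 : L) = 1 := h.2
    rwa [e, mul_smul, h2, R_smul, AlgLoop.one_mul'] at h1
  rw [hv, R_one, one_mul] at e
  rwa [Subtype.ext e]

theorem innerMappingGroup_eq_closure : innerMappingGroup L =
    Subgroup.closure {g | ∃ v w : L, g = R v * R w * R (v * w)} := by
  apply le_antisymm
  · have := congrArg (Subgroup.map (innerMappingGroup L).subtype) (closure_innerGen (L := L))
    rw [MonoidHom.map_closure, ← MonoidHom.range_eq_map, Subgroup.range_subtype] at this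
    rw [← this]
    refine Subgroup.closure_mono ?_
    rintro _ ⟨_, ⟨⟨v, x⟩, rfl⟩, rfl⟩
    exact ⟨x * v, v, by rw [mul_mul_cancel_right]; rfl⟩
  · rw [Subgroup.closure_le]
    rintro _ ⟨v, w, rfl⟩
    have := (innerGen w (v * w)).2
    rwa [coe_innerGen, mul_mul_cancel_right] at this

theorem mem_zpowers_R {v : L} {g : multGroup L} (hg : g ∈ Subgroup.zpowers (R v)) :
    g = 1 ∨ g = R v := by
  obtain ⟨k, rfl⟩ := Subgroup.mem_zpowers_iff.1 hg
  obtain ⟨m, rfl⟩ | ⟨m, rfl⟩ := Int.even_or_odd k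
  · left
    rw [← two_mul, zpow_mul, zpow_two, R_mul_self, one_zpow]
  · right
    rw [zpow_add, zpow_mul, zpow_two, R_mul_self, one_zpow, one_mul, zpow_one]

theorem card_zpowers_R {v : L} (hv : v ≠ 1) : Nat.card (Subgroup.zpowers (R v)) = 2 := by
  rw [Nat.card_zpowers]
  exact orderOf_eq_prime (by rw [pow_two, R_mul_self]) (R_ne_one hv)

end Generation

/-! ### Freeness of the inner mapping group from the universal property. -/

section Free

variable {L : Type u} [SteinerLoop L] {H : Type u} [Group H]

/-- The permutation of `L × H` given by right translation on `L`, twisted by the cocycle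
`c v x * (c v (x * v))⁻¹`. -/
def twistedTranslation (c : L → L → H) (v : L) : Equiv.Perm (L × H) :=
  Function.Involutive.toPerm (fun p => (p.1 * v, c v p.1 * (c v (p.1 * v))⁻¹ * p.2)) fun p => by
    ext
    · exact mul_mul_cancel_right _ _
    · simp only [mul_mul_cancel_right]
      group

theorem twistedTranslation_apply (c : L → L → H) (v x : L) (h : H) :
    twistedTranslation c v (x, h) = (x * v, c v x * (c v (x * v))⁻¹ * h) := rfl

theorem twistedTranslation_mul_self (c : L → L → H) (v : L) :
    twistedTranslation c v * twistedTranslation c v = 1 :=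
  Equiv.ext fun p => (twistedTranslation c v).left_inv p

/-- The cocycle carried by the value at `(1, 1)` of an action of the multiplication group by twisted
translations, restricted to the inner mapping group, is a homomorphism. -/
theorem exists_hom_of_twistedTranslation (c : L → L → H) (φ : multGroup L →* Equiv.Perm (L × H))
    (hφ : ∀ v, φ (R v) = twistedTranslation c v) :
    ∃ F : innerMappingGroup L →* H, ∀ g, F g = (φ g (1, 1)).2 := by
  have h1 : ∀ (g : multGroup L) p, (φ g p).1 = g • p.1 := by
    intro g p
    induction g using multGroup_induction with
    | one => rw [map_one, one_smul]; rfl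
    | mul v g ih => rw [map_mul, hφ, mul_smul, ← ih]; rfl
  -- The cocycle multiplies on the left, so the action commutes with right multiplication on `H`.
  have h2 : ∀ (g : multGroup L) (x : L) (h k : H), (φ g (x, h * k)).2 = (φ g (x, h)).2 * k := by
    intro g x h k
    induction g using multGroup_induction with
    | one => rw [map_one]; rfl
    | mul v g ih =>
      have e : (φ g (x, h * k)).1 = (φ g (x, h)).1 := by rw [h1, h1]
      rw [map_mul, hφ, Equiv.Perm.mul_apply, Equiv.Perm.mul_apply]
      change _ * (φ g (x, h * k)).2 = (_ * (φ g (x, h)).2) * k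
      rw [ih, e]
      simp only [mul_assoc]
  refine ⟨MonoidHom.mk' (fun g => (φ g (1, 1)).2) fun g h => ?_, fun g => rfl⟩
  -- An inner mapping keeps the fibre over `1`.
  have e : φ h (1, 1) = (1, 1 * (φ h (1, 1)).2) :=
    Prod.ext ((h1 h (1, 1)).trans h.2) (one_mul _).symm
  rw [Subgroup.coe_mul, map_mul, Equiv.Perm.mul_apply, e, h2, one_mul]

open Classical in
/-- If the right translations of a Steiner loop satisfy no relations in the multiplication group
besides `R_v ^ 2 = 1` and `R_1 = 1`, then the inner mapping group is free. -/
theorem isFreeGroup_innerMappingGroup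
    (univ : ∀ (A : Type u) (f : L → Equiv.Perm A), f 1 = 1 → (∀ v, f v * f v = 1) →
      ∃ φ : multGroup L →* Equiv.Perm A, ∀ v, φ (R v) = f v) :
    IsFreeGroup (innerMappingGroup L) := by
  let _ : LinearOrder L := linearOrderOfSTO WellOrderingRel
  -- The basis: trivial generators are dropped, and the arbitrary order picks one point of each pair
  -- `x`, `x * v`.
  let P : L × L → Prop := fun p => p.1 ≠ 1 ∧ p.2 ≠ 1 ∧ p.2 ≠ p.1 ∧ p.2 < p.2 * p.1
  refine IsFreeGroup.ofUniqueLift {p // P p} (fun p => innerGen p.1.1 p.1.2) ?_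
  intro H _ f
  -- With the default `1`, the twist at `x` is the prescribed value when `P (v, x)` holds, and its
  -- inverse at `x * v`.
  let c : L → L → H := fun v x => if h : P (v, x) then f ⟨(v, x), h⟩ else 1
  have c_one_left : ∀ x, c 1 x = 1 := fun x => dif_neg fun h => h.1 rfl
  have c_one_right : ∀ v, c v 1 = 1 := fun v => dif_neg fun h => h.2.1 rfl
  have c_self : ∀ v, c v v = 1 := fun v => dif_neg fun h => h.2.2.1 rfl
  obtain ⟨φ, hφ⟩ := univ (L × H) (twistedTranslation c)
    (Equiv.ext fun ⟨x, h⟩ => by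
      rw [twistedTranslation_apply, c_one_left, c_one_left, AlgLoop.mul_one']
      simp)
    (twistedTranslation_mul_self c)
  obtain ⟨F, hF⟩ := exists_hom_of_twistedTranslation c φ hφ
  have hFf : ∀ p : {p // P p}, F (innerGen p.1.1 p.1.2) = f p := by
    rintro ⟨⟨v, x⟩, h⟩
    have hn : ¬ P (v, x * v) := fun h' => by
      have h2 := h'.2.2.2
      dsimp only at h2
      rw [mul_mul_cancel_right] at h2
      exact lt_asymm h2 h.2.2.2
    have e1 : c v x = f ⟨(v, x), h⟩ := dif_pos h
    have e2 : c v (x * v) = 1 := dif_neg hn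
    -- The base point runs `1`, `x`, `x * v`, `1`; the first and last moves have trivial twist, the
    -- middle one contributes `f`.
    rw [hF, coe_innerGen, map_mul, map_mul, hφ, hφ, hφ, Equiv.Perm.mul_apply,
      Equiv.Perm.mul_apply, twistedTranslation_apply, twistedTranslation_apply,
      twistedTranslation_apply, AlgLoop.one_mul', c_one_right, c_self, c_self, e1, e2, mul_self,
      c_one_right]
    simp
  refine ⟨F, hFf, fun F' hF' => MonoidHom.eq_of_eqOn_dense closure_innerGen ?_⟩
  rintro _ ⟨⟨v, x⟩, rfl⟩
  change F' (innerGen v x) = F (innerGen v x)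
  have agree : ∀ x, P (v, x) → F' (innerGen v x) = F (innerGen v x) := fun x h =>
    (hF' ⟨(v, x), h⟩).trans (hFf ⟨(v, x), h⟩).symm
  rcases eq_or_ne v 1 with rfl | hv
  · rw [innerGen_one_left, map_one, map_one]
  rcases eq_or_ne x 1 with rfl | hx
  · rw [innerGen_one_right, map_one, map_one]
  rcases eq_or_ne x v with rfl | hxv
  · rw [innerGen_self, map_one, map_one]
  rcases lt_trichotomy x (x * v) with h | h | h
  · exact agree x ⟨hv, hx, hxv, h⟩
  · refine absurd ?_ hv
    rw [← mul_mul_cancel x v, ← h, mul_self]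
  · have := agree (x * v) ⟨hv, fun e => hxv ?_, fun e => hx ?_, by
      simpa only [mul_mul_cancel_right] using h⟩
    · rwa [innerGen_mul_left_inv, map_inv, map_inv, inv_inj] at this
    · rw [← mul_mul_cancel_right x v, show x * v = _ from e, AlgLoop.one_mul']
    · rw [← mul_mul_cancel_right x v, show x * v = _ from e, mul_self]

end Free

end SteinerLoop
-- Growth of words under translations.
namespace FreeSteiner

open AlgLoop

variable {X : Type u} [LinearOrder X]

theorem word_ne_one (v : SWord X) : (FreeSteinerLoop.word v : FreeSteinerLoop X) ≠ 1 :=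
  nofun

theorem IsProd.length {v a b : SWord X} (h : IsProd v a b) :
    v.1.length = a.1.length + b.1.length := by
  rcases h with h | h <;> rw [h, FreeMagma.length]
  exact add_comm _ _

/-- A long word `b` does not have `v` as a factor: then `b * v` is a longer irreducible word. -/
theorem exists_isProd_of_length_lt {v b : SWord X} (hlt : v.1.length < b.1.length)
    (hv : ¬ IsFactor v.1 b.1) :
    ∃ u, IsProd u v b ∧
      (FreeSteinerLoop.word b * FreeSteinerLoop.word v : FreeSteinerLoop X) = .word u := by
  obtain ⟨u, hu, e⟩ := exists_mulWord (a := b) (b := v) (fun e => by rw [e] at hlt; omega)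
    (fun h => by have := h.length_lt; omega) hv
  exact ⟨u, hu.symm, e⟩

/-- A product of right translations by successively different words lengthens every long word which
does not have the first of them as a factor. -/
theorem exists_isProd_prod_smul {n : ℕ} {a : SWord X} (hn : n < a.1.length) (v : SWord X)
    (l : List (SWord X)) (hc : (v :: l).IsChain (· ≠ ·)) (hl : ∀ w ∈ v :: l, w.1.length ≤ n)
    (ha : ¬ IsFactor ((v :: l).getLast (List.cons_ne_nil v l)).1 a.1) :
    ∃ b a' : SWord X, (((v :: l).map fun w => R (FreeSteinerLoop.word w)).prod •
      (FreeSteinerLoop.word a : FreeSteinerLoop X)) = .word b ∧ IsProd b v a' ∧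
      a.1.length ≤ a'.1.length := by
  induction l generalizing v with
  | nil =>
    obtain ⟨u, hu, e⟩ := exists_isProd_of_length_lt ((hl v (by simp)).trans_lt hn) ha
    refine ⟨u, a, ?_, hu, le_rfl⟩
    rw [List.map_singleton, List.prod_singleton, SteinerLoop.R_smul, e]
  | cons w l ih =>
    rw [List.isChain_cons_cons] at hc
    obtain ⟨b, a', hb, hp, hlen⟩ := ih w hc.2 (fun u hu => hl u (List.mem_cons_of_mem _ hu))
      (by rwa [List.getLast_cons (List.cons_ne_nil w l)] at ha)
    have hbl := hp.length
    have hvn := hl v (by simp)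
    -- The factors of `b` are `w`, which differs from `v`, and `a'`, which is longer than `v`.
    obtain ⟨u, hu, e⟩ := exists_isProd_of_length_lt (v := v) (b := b) (by omega) (fun h => by
      have : v.1 = w.1 ∨ v.1 = a'.1 := by
        rcases hp with hp | hp <;> rw [hp] at h
        · exact h
        · exact h.symm
      rcases this with h | h
      · exact hc.1 (Subtype.ext h)
      · have := congrArg FreeMagma.length h
        omega)
    refine ⟨u, b, ?_, hu, by omega⟩
    rw [List.map_cons, List.prod_cons, mul_smul, hb, SteinerLoop.R_smul, e]

/-- A word has at most two factors, so among three letters one can always be multiplied on. -/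
theorem exists_length_ge [Finite X] (h : 2 < Nat.card X) (n : ℕ) :
    ∃ w : SWord X, n ≤ w.1.length := by
  have := Fintype.ofFinite X
  rw [Nat.card_eq_fintype_card, Fintype.two_lt_card_iff] at h
  obtain ⟨x, y, z, hxy, hxz, hyz⟩ := h
  have step : ∀ w : SWord X, ∃ t : X, FreeMagma.of t ≠ w.1 ∧ ¬ IsFactor (.of t) w.1 := by
    rintro ⟨_ | ⟨a, b⟩, hw⟩
    · rename_i s
      by_cases hs : x = s
      · exact ⟨y, fun e => hxy (hs.trans (by cases e; rfl)), id⟩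
      · exact ⟨x, fun e => hs (by cases e; rfl), id⟩
    · by_contra! hcon
      have hx := hcon x nofun
      have hy := hcon y nofun
      have hz := hcon z nofun
      simp only [IsFactor] at hx hy hz
      have inj : ∀ s t : X, FreeMagma.of s = FreeMagma.of t → s = t := fun s t e => by
        cases e; rfl
      grind
  induction n with
  | zero => exact ⟨⟨.of x, trivial⟩, Nat.zero_le _⟩
  | succ n ih =>
    obtain ⟨w, hw⟩ := ih
    obtain ⟨t, h1, h2⟩ := step w
    obtain ⟨u, hu, -⟩ := exists_mulWord (a := w) (b := ⟨.of t, trivial⟩)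
      (fun e => h1 (congrArg Subtype.val e).symm) id h2
    refine ⟨u, ?_⟩
    have := hu.length
    simp only [FreeMagma.length] at this
    omega

/-- A nonempty product of right translations by successively different words is not the
identity. -/
theorem prod_R_ne_one [Finite X] (h : 2 < Nat.card X) {l : List (SWord X)} (hl : l ≠ [])
    (hc : l.IsChain (· ≠ ·)) : (l.map fun w => R (FreeSteinerLoop.word w)).prod ≠ 1 := by
  obtain ⟨v, l, rfl⟩ := List.exists_cons_of_ne_nil hl
  obtain ⟨n, hn⟩ : ∃ n, ∀ w ∈ v :: l, w.1.length ≤ n :=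
    ⟨((v :: l).map fun w => w.1.length).sum, fun w hw =>
      List.single_le_sum (fun _ _ => Nat.zero_le _) _ (List.mem_map_of_mem hw)⟩
  obtain ⟨a, hna, ha⟩ : ∃ a : SWord X, n < a.1.length ∧
      ¬ IsFactor ((v :: l).getLast (List.cons_ne_nil v l)).1 a.1 := by
    -- If the first acting word is a factor of `a`, the other factor replaces `a`: it still has
    -- length above `n`, and irreducibility of `a` keeps the acting word from being its factor.
    obtain ⟨a, ha⟩ := exists_length_ge h (2 * n + 1)
    by_cases hf : IsFactor ((v :: l).getLast (List.cons_ne_nil v l)).1 a.1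
    · obtain ⟨u, hu⟩ := hf.exists_isProd
      have h1 := hu.length
      have h2 := hn _ (List.getLast_mem (List.cons_ne_nil v l))
      exact ⟨u, by omega, hu.facts.2.2.2.1⟩
    · exact ⟨a, by omega, hf⟩
  obtain ⟨b, a', hb, hp, hle⟩ := exists_isProd_prod_smul hna v l hc hn ha
  intro e
  rw [e, one_smul] at hb
  have h1 := hp.length
  have h2 := v.1.length_pos
  rw [← FreeSteinerLoop.word.inj hb] at h1
  omega

theorem IsSWord.exists_eq_of [Subsingleton X] :
    ∀ w : FreeMagma X, IsSWord w → ∃ x, w = .of x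
  | .of x, _ => ⟨x, rfl⟩
  | .mul w v, h => by
    obtain ⟨x, rfl⟩ := IsSWord.exists_eq_of w h.1
    obtain ⟨y, rfl⟩ := IsSWord.exists_eq_of v h.2.1
    exact absurd h.2.2.1 (by simp [WordLT, Subsingleton.elim y x])

instance [Subsingleton X] : Subsingleton (SWord X) where
  allEq := by
    rintro ⟨v, hv⟩ ⟨w, hw⟩
    obtain ⟨x, rfl⟩ := IsSWord.exists_eq_of v hv
    obtain ⟨y, rfl⟩ := IsSWord.exists_eq_of w hw
    exact Subtype.ext (congrArg FreeMagma.of (Subsingleton.elim x y))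

/-! ### The free product decomposition and its universal property. -/

variable (X) in
/-- The canonical homomorphism from the free product of the groups `⟨R_v⟩`. -/
noncomputable def coprodHom :
    Monoid.CoprodI (fun v : SWord X => Subgroup.zpowers (R (FreeSteinerLoop.word v))) →*
      multGroup (FreeSteinerLoop X) :=
  Monoid.CoprodI.lift fun v : SWord X =>
    (Subgroup.zpowers (R (FreeSteinerLoop.word v))).subtype

theorem coprodHom_injective (hX : ∀ l : List (SWord X), l ≠ [] → l.IsChain (· ≠ ·) →
      (l.map fun w => R (FreeSteinerLoop.word w)).prod ≠ 1) :
    Function.Injective (coprodHom X) := by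
  classical
  rw [injective_iff_map_eq_one]
  intro x hx
  obtain ⟨w, rfl⟩ := Monoid.CoprodI.Word.equiv.symm.surjective x
  have key : coprodHom X (Monoid.CoprodI.Word.prod w) =
      ((w.toList.map Sigma.fst).map fun w => R (FreeSteinerLoop.word w)).prod := by
    -- A nontrivial syllable in a group generated by an involution is that involution, so the
    -- indices determine a reduced word.
    rw [Monoid.CoprodI.Word.prod, map_list_prod, List.map_map, List.map_map]
    congr 1
    refine List.map_congr_left fun p hp => ?_
    rw [Function.comp_apply, Function.comp_apply, coprodHom, Monoid.CoprodI.lift_of]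
    exact (SteinerLoop.mem_zpowers_R p.2.2).resolve_left fun h =>
      w.ne_one p hp (Subtype.ext h)
  by_cases hw : w.toList = []
  · change Monoid.CoprodI.Word.prod w = 1
    rw [Monoid.CoprodI.Word.prod, hw]
    rfl
  · refine absurd (key.symm.trans hx) (hX _ (by simpa using hw) ?_)
    rw [List.isChain_map]
    exact w.chain_ne

theorem coprodHom_of (v : SWord X) :
    coprodHom X (Monoid.CoprodI.of ⟨R (FreeSteinerLoop.word v), Subgroup.mem_zpowers _⟩) =
      R (FreeSteinerLoop.word v) := by
  rw [coprodHom, Monoid.CoprodI.lift_of]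
  rfl

theorem coprodHom_surjective : Function.Surjective (coprodHom X) := fun g => by
  induction g using SteinerLoop.multGroup_induction with
  | one => exact ⟨1, map_one _⟩
  | mul v g ih =>
    obtain ⟨x, rfl⟩ := ih
    rcases v with _ | v
    · exact ⟨x, by rw [show (FreeSteinerLoop.empty : FreeSteinerLoop X) = 1 from rfl,
        SteinerLoop.R_one, one_mul]⟩
    · exact ⟨_ * x, by rw [map_mul, coprodHom_of]⟩

theorem coprodHom_bijective [Finite X] (h : Nat.card X ≠ 2) :
    Function.Bijective (coprodHom X) := by
  refine ⟨coprodHom_injective fun l hl hc => ?_, coprodHom_surjective⟩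
  rcases h.lt_or_gt with h | h
  · have : Subsingleton X := Finite.card_le_one_iff_subsingleton.1 (by omega)
    rcases l with _ | ⟨v, _ | ⟨w, l⟩⟩
    · exact absurd rfl hl
    · simpa using SteinerLoop.R_ne_one (word_ne_one v)
    · exact absurd (Subsingleton.elim v w) (List.isChain_cons_cons.1 hc).1
  · exact prod_R_ne_one h hl hc

open Classical in
-- A homomorphism from a group of order two is a choice of an element with square `1`; the free
-- product glues these choices.
theorem exists_hom_of_coprodHom_bijective (h : Function.Bijective (coprodHom X)) {A : Type*}
    [Group A] (f : FreeSteinerLoop X → A) (h1 : f 1 = 1) (hf : ∀ v, f v * f v = 1) :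
    ∃ φ : multGroup (FreeSteinerLoop X) →* A, ∀ v, φ (R v) = f v := by
  let ψ : ∀ v : SWord X, Subgroup.zpowers (R (FreeSteinerLoop.word v)) →* A := fun v =>
    MonoidHom.mk' (fun g => if g = 1 then 1 else f (.word v)) fun a b => by
      have hne := SteinerLoop.R_ne_one (word_ne_one v)
      obtain ⟨a, ha⟩ := a
      obtain ⟨b, hb⟩ := b
      rcases SteinerLoop.mem_zpowers_R ha with rfl | rfl <;>
        rcases SteinerLoop.mem_zpowers_R hb with rfl | rfl <;>
        simp [Subtype.ext_iff, SteinerLoop.R_mul_self, hne, hf]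
  let e := MulEquiv.ofBijective (coprodHom X) h
  refine ⟨(Monoid.CoprodI.lift ψ).comp e.symm.toMonoidHom, fun v => ?_⟩
  rcases v with _ | v
  · change _ = f 1
    rw [h1, show (FreeSteinerLoop.empty : FreeSteinerLoop X) = 1 from rfl, SteinerLoop.R_one,
      map_one]
  · have : e.symm (R (FreeSteinerLoop.word v)) =
        Monoid.CoprodI.of ⟨R (FreeSteinerLoop.word v), Subgroup.mem_zpowers _⟩ := by
      rw [MulEquiv.symm_apply_eq]
      exact (coprodHom_of v).symm
    change Monoid.CoprodI.lift ψ (e.symm _) = _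
    rw [this, Monoid.CoprodI.lift_of]
    exact if_neg fun h => SteinerLoop.R_ne_one (word_ne_one v) (congrArg Subtype.val h)

/-! ### The two-letter case. -/

theorem IsSWord.eq_of_forall_eq {x y : X} (hxy : x < y) (hX : ∀ z, z = x ∨ z = y) :
    ∀ w : FreeMagma X, IsSWord w → w = .of x ∨ w = .of y ∨ w = .mul (.of y) (.of x)
  | .of z, _ => by rcases hX z with rfl | rfl <;> simp
  | .mul w v, h => by
    have h1 := IsSWord.eq_of_forall_eq hxy hX w h.1
    have h2 := IsSWord.eq_of_forall_eq hxy hX v h.2.1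
    obtain ⟨-, -, h3, h4⟩ := h
    clear hX
    rcases h1 with rfl | rfl | rfl <;> rcases h2 with rfl | rfl | rfl <;>
      simp_all [WordLT, IsFactor]
    -- The case left is `x` times `y` in the wrong order.
    exact absurd hxy h3.asymm

/-- The free Steiner loop on two letters is a group. -/
theorem mul_assoc_of_card_eq_two (h : Nat.card X = 2) (a b c : FreeSteinerLoop X) :
    a * b * c = a * (b * c) := by
  have := Nat.finite_of_card_ne_zero (by omega : Nat.card X ≠ 0)
  obtain ⟨x, y, hxy, hX⟩ : ∃ x y : X, x < y ∧ ∀ z, z = x ∨ z = y := by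
    obtain ⟨x, y, hne, hu⟩ := Nat.card_eq_two_iff.1 h
    have hX : ∀ z, z = x ∨ z = y := fun z => by
      have : z ∈ ({x, y} : Set X) := hu ▸ Set.mem_univ z
      simpa using this
    rcases hne.lt_or_gt with h | h
    · exact ⟨x, y, h, hX⟩
    · exact ⟨y, x, h, fun z => (hX z).symm⟩
  let p : FreeSteinerLoop X := .word ⟨.of x, trivial⟩
  let q : FreeSteinerLoop X := .word ⟨.of y, trivial⟩
  have hr : IsSWord (.mul (.of y) (.of x)) := ⟨trivial, trivial, hxy, id⟩
  let r : FreeSteinerLoop X := .word ⟨_, hr⟩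
  have hall : ∀ a : FreeSteinerLoop X, a = 1 ∨ a = p ∨ a = q ∨ a = r := by
    rintro (_ | ⟨w, hw⟩)
    · exact Or.inl rfl
    · rcases IsSWord.eq_of_forall_eq hxy hX w hw with rfl | rfl | rfl
      · exact Or.inr (Or.inl rfl)
      · exact Or.inr (Or.inr (Or.inl rfl))
      · exact Or.inr (Or.inr (Or.inr rfl))
  have hP : IsProd ⟨_, hr⟩ ⟨.of y, trivial⟩ ⟨.of x, trivial⟩ := Or.inl rfl
  have qp : q * p = r := mulWord_of_isProd hP
  have pq : p * q = r := mulWord_of_isProd hP.symm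
  have rq : r * q = p := mulWord_left hP
  have qr : q * r = p := mulWord_right hP
  have rp : r * p = q := mulWord_left hP.symm
  have pr : p * r = q := mulWord_right hP.symm
  rcases hall a with rfl | rfl | rfl | rfl <;> rcases hall b with rfl | rfl | rfl | rfl <;>
    rcases hall c with rfl | rfl | rfl | rfl <;>
    simp only [AlgLoop.one_mul', AlgLoop.mul_one', SteinerLoop.mul_self, qp, pq, rq, qr, rp, pr]

theorem innerMappingGroup_eq_bot (h : Nat.card X = 2) :
    innerMappingGroup (FreeSteinerLoop X) = ⊥ := by
  rw [SteinerLoop.innerMappingGroup_eq_closure, Subgroup.closure_eq_bot_iff]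
  rintro _ ⟨v, w, rfl⟩
  refine SteinerLoop.multGroup_ext fun x => ?_
  rw [mul_smul, mul_smul, SteinerLoop.R_smul, SteinerLoop.R_smul, SteinerLoop.R_smul,
    ← mul_assoc_of_card_eq_two h, SteinerLoop.mul_mul_cancel_right,
    SteinerLoop.mul_mul_cancel_right, one_smul]

theorem isFreeGroup_innerMappingGroup [Finite X] :
    IsFreeGroup (innerMappingGroup (FreeSteinerLoop X)) := by
  by_cases h : Nat.card X = 2
  · rw [innerMappingGroup_eq_bot h]
    exact IsFreeGroup.ofMulEquiv (MulEquiv.ofUnique : FreeGroup PEmpty.{u + 1} ≃* _)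
  · exact SteinerLoop.isFreeGroup_innerMappingGroup fun A f h1 hf =>
      exists_hom_of_coprodHom_bijective (coprodHom_bijective h) f h1 hf

end FreeSteiner


theorem mainTheorem6 {X : Type*} [LinearOrder X] [Finite X] :
    -- unless `X` has two elements, the multiplication group is the free product of its subgroups
    -- `⟨R_v⟩`, each of order two, where `v` runs through the irreducible words
    (Nat.card X ≠ 2 →
      (∀ v : SWord X,
        Nat.card (Subgroup.zpowers (AlgLoop.R (FreeSteinerLoop.word v))) = 2) ∧
      Function.Bijective
        (Monoid.CoprodI.lift fun v : SWord X =>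
          (Subgroup.zpowers (AlgLoop.R (FreeSteinerLoop.word v))).subtype)) ∧
    -- the factorization `G = {R_v} Stab(∅)`
    (∀ g : AlgLoop.multGroup (FreeSteinerLoop X), ∃ v : FreeSteinerLoop X,
      ∃ h ∈ AlgLoop.innerMappingGroup (FreeSteinerLoop X), g = AlgLoop.R v * h) ∧
    -- the inner mapping group is free, and generated by the elements `R_v R_w R_{vw}`
    IsFreeGroup (AlgLoop.innerMappingGroup (FreeSteinerLoop X)) ∧
    AlgLoop.innerMappingGroup (FreeSteinerLoop X) =
      Subgroup.closure
        {g | ∃ v w : FreeSteinerLoop X,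
          g = AlgLoop.R v * AlgLoop.R w * AlgLoop.R (v * w)} := by
  exact ⟨fun h => ⟨fun v => SteinerLoop.card_zpowers_R (FreeSteiner.word_ne_one v),
      FreeSteiner.coprodHom_bijective h⟩,
    SteinerLoop.exists_eq_R_mul, FreeSteiner.isFreeGroup_innerMappingGroup,
    SteinerLoop.innerMappingGroup_eq_closure⟩
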